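/- Let $(X_n)_{n\ge 0}$ be a linearly vertex-reinforced random walk on $\mathbb{Z}$ started at a point $v_0\in\mathbb{Z}$: writing $\mathcal{F}_n=\sigma(X_0,\dots,X_n)$ and $$Z_n(v)=1+\sum_{k=0}^{n}\mathbf{1}_{\{X_k=v\}}\quad(n\in\mathbb{N}\cup\{\infty\},\ v\in\mathbb{Z}),$$ one has $X_0=v_0$ almost surely and, almost surely for all $n\ge0$ and $j\in\mathbb{Z}$, $$\mathbb{P}(X_{n+1}=j\mid\mathcal{F}_n)=\mathbf{1}_{\{|j-X_n|=1\}}\,\frac{Z_n(j)}{Z_n(X_n-1)+Z_n(X_n+1)} .$$ For $x\in\mathbb{Z}$ let $\alpha_n^{\pm}(x)=\dfrac{Z_n(x\pm1)}{Z_n(x-1)+Z_n(x+1)}$. For all $\gamma\in[0,1)$, $\epsilon>0$ and $C>0$ there is a constant $K=K(\gamma,\epsilon,C)$, depending only on $\gamma,\epsilon,C$, such that for every such walk, each of the two choices of the sign $\pm$ (the same sign throughout), every $x\in\mathbb{Z}$ and every $m\in\mathbb{N}=\{0,1,2,\dots\}$, almost surely on the event $$\{Z_m(x\pm3)=1\}\cap\{Z_m(x\pm2)\le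 C\,Z_m(x)^{\gamma}\}\cap\{\alpha_m^{\pm}(x)\le\gamma\}$$ one has $$\mathbb{P}\Big(\{Z_\infty(x\pm3)\ne1\}\cup\{\sup_{n\ge m}\alpha_n^{\pm}(x)>\gamma+\epsilon\}\,\Big|\,\mathcal{F}_m\Big)\le K\left(Z_m(x)^{-\gamma}+Z_m(x\pm1)^{\gamma+\epsilon-1}\right).$$ -/

import Mathlib

open MeasureTheory ProbabilityTheory

namespace VRRW

variable {Ω : Type*}

/-- `Z_n(v)`: the number of visits of the path to `v` up to time `n` (time `0` included),
plus one. -/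
def Z (X : ℕ → Ω → ℤ) (n : ℕ) (v : ℤ) (ω : Ω) : ℕ :=
  (∑ k ∈ Finset.range (n + 1), if X k ω = v then 1 else 0) + 1

/-- `Z_∞(v)`: the total number of visits of the path to `v` (possibly infinite), plus one. -/
noncomputable def ZInf (X : ℕ → Ω → ℤ) (v : ℤ) (ω : Ω) : ℕ∞ :=
  {k : ℕ | X k ω = v}.encard + 1

/-- `α_n^s(x) = Z_n(x + s) / (Z_n(x - 1) + Z_n(x + 1))`, to be used with `s = 1` or `s = -1`. -/
noncomputable def α (X : ℕ → Ω → ℤ) (s : ℤ) (n : ℕ) (x : ℤ) (ω : Ω) : ℝ :=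
  (Z X n (x + s) ω : ℝ) / ((Z X n (x - 1) ω : ℝ) + (Z X n (x + 1) ω : ℝ))

/-- `X` is a (linearly) vertex-reinforced random walk on `ℤ` started at `v₀`, with weight function
`W(n) = n`: given the past `ℱ_n = σ(X_0, …, X_n)`, the walk jumps to a neighbour `j` of its
current position with probability proportional to `Z_n(j)`. -/
structure IsVRRW [MeasurableSpace Ω] (P : Measure Ω) (v₀ : ℤ) (X : ℕ → Ω → ℤ) : Prop where
  measurable : ∀ n, Measurable (X n)
  start : ∀ᵐ ω ∂P, X 0 ω = v₀
  step : ∀ (n : ℕ) (j : ℤ),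
    P⟦X (n + 1) ⁻¹' {j} |
        Filtration.natural X (fun k => (measurable k).stronglyMeasurable) n⟧
      =ᵐ[P] fun ω =>
        if j = X n ω - 1 ∨ j = X n ω + 1 then
          (Z X n j ω : ℝ) / ((Z X n (X n ω - 1) ω : ℝ) + (Z X n (X n ω + 1) ω : ℝ))
        else 0

/-- The filtration `ℱ_n = σ(X_0, …, X_n)` of the past of the walk. -/
def IsVRRW.filtration [mΩ : MeasurableSpace Ω] {P : Measure Ω} {v₀ : ℤ} {X : ℕ → Ω → ℤ}
    (h : IsVRRW P v₀ X) : Filtration ℕ mΩ :=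
  Filtration.natural X (fun k => (h.measurable k).stronglyMeasurable)

end VRRW

/-! By translation and reflection take x = 0 and the sign +, and write a, b, c, d for the counts at
-1, 0, 1, 2 and α = c/(a+c). If γ + ε ≥ 1 or b = 1 at time m, the right-hand side is at least 1 as
soon as K ≥ 1. Otherwise a nonnegative function `lyapunov` of position and profile is a
supermartingale until site 3 is hit or α exceeds γ + ε, and it is at least 1 at that moment. The
escape probability is therefore at most its value at time m, which is O(c^(γ+ε-1)) by `lyapunov_le`.

The drift bound `lyapunov_average_le` balances the following costs, with E = `excursionCost` and A =
`sideWeight`. From 0, the pair (a, c) moves like a Pólya urn, so α is a martingale, and its variance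
is paid by the drop of 1/(a+c). From 2, the walk hits 3 with probability 1/(c+1) or returns to 1 and
raises α by at most 1/(c+1); E/(c+1) prepays both. From 1, the weight d/(b-1) prices the excursions
to 2 exactly. The surcharge on arriving at 1 from 0 is paid by the steps from 0 to -1, which lower
d/(b-1) to d/b and have probability 1 - α ≥ 1 - (γ+ε); this fixes A. -/

namespace VRRW

open scoped ENNReal

/-! ### The Lyapunov function. -/

/-- The part of the Lyapunov function that controls the fraction `c / (a + c)`. -/
noncomputable def ratioEnergy (γ ε a c : ℝ) : ℝ :=
  (max (c / (a + c) - γ) 0 ^ 2 + 1 / (a + c)) / ε ^ 2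

/-- The cost of one excursion from site `1` to site `2`, up to a factor `1 / (z 1 + 1)`. -/
noncomputable def excursionCost (ε : ℝ) : ℝ := 1 + 3 / ε ^ 2

/-- The weight of `z 2 / z 0` in the Lyapunov function. -/
noncomputable def sideWeight (γ ε : ℝ) : ℝ := excursionCost ε / (1 - (γ + ε))

/-- The part of the Lyapunov function that controls the number of visits to site `2`,
when the walk is at `y ≤ 2`. -/
noncomputable def sideEnergy (γ ε : ℝ) (y : ℤ) (b c d : ℝ) : ℝ :=
  if y < 0 then sideWeight γ ε * d / b
  else if y = 0 then sideWeight γ ε * d / (b - 1)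
  else if y = 1 then d * (sideWeight γ ε + excursionCost ε / (c + 1)) / (b - 1)
  else excursionCost ε / (c + 1) +
    d * (sideWeight γ ε + excursionCost ε / (c + 1)) / (b - 1)

/-- The Lyapunov function: `y` is the position of the walk and `z` its occupation profile. -/
noncomputable def lyapunov (γ ε : ℝ) (y : ℤ) (z : ℤ → ℝ) : ℝ :=
  if 3 ≤ y then 1 else ratioEnergy γ ε (z (-1)) (z 1) + sideEnergy γ ε y (z 0) (z 1) (z 2)

/-- The occupation profile after a visit to `j`. -/
noncomputable def bump (z : ℤ → ℝ) (j : ℤ) : ℤ → ℝ := fun v => z v + if j = v then 1 else 0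

theorem excursionCost_pos (ε : ℝ) : 0 < excursionCost ε := by
  unfold excursionCost; positivity

theorem sideWeight_pos {γ ε : ℝ} (h : γ + ε < 1) : 0 < sideWeight γ ε :=
  div_pos (excursionCost_pos ε) (by linarith)

theorem ratioEnergy_nonneg (γ ε : ℝ) {a c : ℝ} (ha : 0 < a) (hc : 0 < c) :
    0 ≤ ratioEnergy γ ε a c := by
  unfold ratioEnergy; positivity

theorem sideEnergy_nonneg {γ ε : ℝ} (h : γ + ε < 1) (y : ℤ) {b c d : ℝ} (hb : 1 ≤ b)
    (hc : 0 < c) (hd : 0 < d) : 0 ≤ sideEnergy γ ε y b c d := by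
  have hA := sideWeight_pos h
  have hE := excursionCost_pos ε
  have hb' : 0 ≤ b - 1 := by linarith
  unfold sideEnergy
  split_ifs <;> positivity

theorem lyapunov_nonneg {γ ε : ℝ} (h : γ + ε < 1) (y : ℤ) {z : ℤ → ℝ} (hz : ∀ v, 1 ≤ z v) :
    0 ≤ lyapunov γ ε y z := by
  have h' : ∀ v, 0 < z v := fun v => lt_of_lt_of_le one_pos (hz v)
  unfold lyapunov
  split_ifs
  · exact zero_le_one
  · exact add_nonneg (ratioEnergy_nonneg γ ε (h' _) (h' _))
      (sideEnergy_nonneg h y (hz _) (h' _) (h' _))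

theorem one_le_lyapunov {γ ε : ℝ} (hε : 0 < ε) (h : γ + ε < 1) (y : ℤ) {z : ℤ → ℝ}
    (hz : ∀ v, 1 ≤ z v) (hy : 3 ≤ y ∨ γ + ε ≤ z 1 / (z (-1) + z 1)) :
    1 ≤ lyapunov γ ε y z := by
  have h' : ∀ v, 0 < z v := fun v => lt_of_lt_of_le one_pos (hz v)
  unfold lyapunov
  split_ifs with h3
  · exact le_rfl
  · have hα := hy.resolve_left h3
    have h1 : ε ≤ max (z 1 / (z (-1) + z 1) - γ) 0 := le_max_of_le_left (by linarith)
    have h2 : 1 ≤ ratioEnergy γ ε (z (-1)) (z 1) := by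
      unfold ratioEnergy
      rw [le_div_iff₀ (by positivity)]
      have h3 : 0 ≤ 1 / (z (-1) + z 1) := by have := h' 1; have := h' (-1); positivity
      nlinarith
    have := sideEnergy_nonneg h y (hz 0) (h' 1) (h' 2)
    linarith

/-! ### One-step drift of the Lyapunov function. -/

theorem max_zero_add_sq_le (t h : ℝ) :
    max (t + h) 0 ^ 2 ≤ max t 0 ^ 2 + 2 * max t 0 * h + h ^ 2 := by
  -- The right side is the square of t⁺ + h, and (t + h)⁺ is either 0 or at most t⁺ + h.
  have h1 : max t 0 ^ 2 + 2 * max t 0 * h + h ^ 2 = (max t 0 + h) ^ 2 := by ring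
  rw [h1]
  rcases le_total (t + h) 0 with h2 | h2
  · rw [max_eq_right h2, zero_pow two_ne_zero]; positivity
  · rw [max_eq_left h2]
    exact pow_le_pow_left₀ h2 (by linarith [le_max_left t 0]) 2

theorem ratioEnergy_add_left_le (γ ε : ℝ) {a c : ℝ} (ha : 0 < a) (hc : 0 < c) :
    ratioEnergy γ ε (a + 1) c ≤ ratioEnergy γ ε a c := by
  unfold ratioEnergy
  gcongr <;> linarith

/-- One visit to 1 raises α by some h ≤ 1/(c+1) ≤ 1, so the squared excess grows by at most 2h + h²
≤ 3h: this is the 3 in `excursionCost`. -/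
theorem ratioEnergy_add_right_le {γ : ℝ} (hγ : 0 ≤ γ) (ε : ℝ) {a c : ℝ} (ha : 0 < a)
    (hc : 0 < c) :
    ratioEnergy γ ε a (c + 1) ≤ ratioEnergy γ ε a c + 3 / ε ^ 2 / (c + 1) := by
  unfold ratioEnergy
  rw [div_right_comm, ← add_div]
  refine div_le_div_of_nonneg_right ?_ (by positivity)
  set α := c / (a + c) with hα
  set h := (1 - α) / (a + c + 1) with hh
  have e : (c + 1) / (a + (c + 1)) - γ = (α - γ) + h := by
    rw [hh, hα]; field_simp; ring
  have hα0 : 0 ≤ α := by positivity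
  have hα1 : α ≤ 1 := by rw [hα, div_le_one (by positivity)]; linarith
  have hh0 : 0 ≤ h := div_nonneg (by linarith) (by positivity)
  have hh1 : h ≤ 1 / (c + 1) := by
    rw [hh]; gcongr <;> linarith
  have hh2 : h ≤ 1 := hh1.trans (by rw [div_le_one (by positivity)]; linarith)
  have hm : max (α - γ) 0 ≤ 1 := max_le (by linarith) zero_le_one
  have hM : 1 / (a + (c + 1)) ≤ 1 / (a + c) := by gcongr; linarith
  have := max_zero_add_sq_le (α - γ) h
  have e3 : 3 / (c + 1) = 3 * (1 / (c + 1)) := by ring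
  rw [e, e3]
  nlinarith

/-- The first-order terms cancel because α is a martingale under the urn step. With r = 1/(a+c+1),
the remaining variance α(1-α)r² is at most the drop 1/(a+c) - r. -/
theorem ratioEnergy_average_le (γ ε : ℝ) {a c : ℝ} (ha : 0 < a) (hc : 0 < c) :
    a / (a + c) * ratioEnergy γ ε (a + 1) c + c / (a + c) * ratioEnergy γ ε a (c + 1)
      ≤ ratioEnergy γ ε a c := by
  unfold ratioEnergy
  rw [← mul_div_assoc, ← mul_div_assoc, ← add_div]
  refine div_le_div_of_nonneg_right ?_ (by positivity)
  set α := c / (a + c) with hα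
  have ea : a / (a + c) = 1 - α := by rw [hα]; field_simp; ring
  have e1 : c / (a + 1 + c) - γ = (α - γ) + -(α / (a + c + 1)) := by
    rw [hα]; field_simp; ring
  have e2 : (c + 1) / (a + (c + 1)) - γ = (α - γ) + (1 - α) / (a + c + 1) := by
    rw [hα]; field_simp; ring
  have hα0 : 0 ≤ α := by positivity
  have hα1 : α ≤ 1 := by rw [hα, div_le_one (by positivity)]; linarith
  have h1 := max_zero_add_sq_le (α - γ) (-(α / (a + c + 1)))
  have h2 := max_zero_add_sq_le (α - γ) ((1 - α) / (a + c + 1))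
  have e3 : 1 / (a + 1 + c) = 1 / (a + c + 1) := by ring_nf
  have e4 : 1 / (a + (c + 1)) = 1 / (a + c + 1) := by ring_nf
  rw [ea, e1, e2, e3, e4]
  have h3 := mul_le_mul_of_nonneg_left h1 (sub_nonneg.2 hα1)
  have h4 := mul_le_mul_of_nonneg_left h2 hα0
  set r := 1 / (a + c + 1) with hr
  have hr0 : 0 < r := by positivity
  have e5 : α / (a + c + 1) = α * r := by rw [hr]; ring
  have e6 : (1 - α) / (a + c + 1) = (1 - α) * r := by rw [hr]; ring
  have h5 : r + r ^ 2 ≤ 1 / (a + c) := by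
    rw [hr, le_div_iff₀ (by positivity)]
    have : (1 / (a + c + 1) + (1 / (a + c + 1)) ^ 2) * (a + c)
        = 1 - (1 / (a + c + 1)) ^ 2 := by field_simp; ring
    rw [this]
    linarith [sq_nonneg (1 / (a + c + 1))]
  have h6 : α * (1 - α) * r ^ 2 ≤ r ^ 2 := by
    have : α * (1 - α) ≤ 1 := by nlinarith
    nlinarith [sq_nonneg r]
  rw [e5] at h3 ⊢
  rw [e6] at h4 ⊢
  nlinarith

/-- In units of d/(b-1), going right costs αE/(c+2) ≤ E/(a+c) ≤ E/b, while going left saves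
(1-α)A/b. The saving suffices because A(1-(γ+ε)) = E. -/
theorem sideEnergy_average_le {γ ε : ℝ} (h : γ + ε < 1) {a b c d : ℝ} (ha : 0 < a)
    (hb : 2 ≤ b) (hc : 0 < c) (hd : 0 < d) (hbM : b ≤ a + c) (hα : c / (a + c) ≤ γ + ε) :
    a / (a + c) * (sideWeight γ ε * d / b) +
      c / (a + c) * (d * (sideWeight γ ε + excursionCost ε / (c + 1 + 1)) / (b - 1))
      ≤ sideWeight γ ε * d / (b - 1) := by
  have hE := excursionCost_pos ε
  have hA := sideWeight_pos h
  have hEA : excursionCost ε = sideWeight γ ε * (1 - (γ + ε)) := by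
    unfold sideWeight; rw [div_mul_cancel₀]; linarith
  set E := excursionCost ε
  set A := sideWeight γ ε
  set α := c / (a + c) with hαd
  have ea : a / (a + c) = 1 - α := by rw [hαd]; field_simp; ring
  have h1 : α * (E / (c + 1 + 1)) ≤ E / b := by
    have : α * (E / (c + 1 + 1)) = E / (a + c) * (c / (c + 1 + 1)) := by
      rw [hαd]; field_simp
    rw [this]
    have h2 : c / (c + 1 + 1) ≤ 1 := by rw [div_le_one (by positivity)]; linarith
    calc E / (a + c) * (c / (c + 1 + 1)) ≤ E / (a + c) * 1 := by gcongr
      _ ≤ E / b := by rw [mul_one]; gcongr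
  have hb1 : 0 < b - 1 := by linarith
  rw [ea]
  calc (1 - α) * (A * d / b) + α * (d * (A + E / (c + 1 + 1)) / (b - 1))
      = d / (b - 1) * ((1 - α) * A * ((b - 1) / b) + α * A + α * (E / (c + 1 + 1))) := by
        field_simp
        ring
    _ ≤ d / (b - 1) * ((1 - α) * A * ((b - 1) / b) + α * A + E / b) := by gcongr
    _ = d / (b - 1) * (A - (A * (1 - α) - E) / b) := by field_simp; ring
    _ ≤ d / (b - 1) * A := by
        gcongr
        have : 0 ≤ (A * (1 - α) - E) / b := by
          apply div_nonneg _ (by linarith)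
          rw [hEA]; nlinarith
        linarith
    _ = A * d / (b - 1) := by ring

theorem lyapunov_of_neg {γ ε : ℝ} {y : ℤ} (hy : y < 0) (z : ℤ → ℝ) :
    lyapunov γ ε y z = ratioEnergy γ ε (z (-1)) (z 1) + sideWeight γ ε * z 2 / z 0 := by
  rw [lyapunov, if_neg (by lia), sideEnergy, if_pos hy]

theorem lyapunov_zero (γ ε : ℝ) (z : ℤ → ℝ) :
    lyapunov γ ε 0 z = ratioEnergy γ ε (z (-1)) (z 1) + sideWeight γ ε * z 2 / (z 0 - 1) := by
  simp [lyapunov, sideEnergy]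

theorem lyapunov_one (γ ε : ℝ) (z : ℤ → ℝ) :
    lyapunov γ ε 1 z = ratioEnergy γ ε (z (-1)) (z 1) +
      z 2 * (sideWeight γ ε + excursionCost ε / (z 1 + 1)) / (z 0 - 1) := by
  simp [lyapunov, sideEnergy]

theorem lyapunov_two (γ ε : ℝ) (z : ℤ → ℝ) :
    lyapunov γ ε 2 z = ratioEnergy γ ε (z (-1)) (z 1) + (excursionCost ε / (z 1 + 1) +
      z 2 * (sideWeight γ ε + excursionCost ε / (z 1 + 1)) / (z 0 - 1)) := by
  simp [lyapunov, sideEnergy]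

theorem lyapunov_three (γ ε : ℝ) (z : ℤ → ℝ) : lyapunov γ ε 3 z = 1 := by
  simp [lyapunov]

/-- The Lyapunov function does not increase on average in one step of the walk. -/
theorem lyapunov_average_le {γ ε : ℝ} (hγ : 0 ≤ γ) (h : γ + ε < 1) {y : ℤ}
    (hy : y ≤ 2) {z : ℤ → ℝ} (hz : ∀ v, 1 ≤ z v) (hz0 : 2 ≤ z 0) (hz3 : z 3 = 1)
    (hM : z 0 ≤ z (-1) + z 1) (hα : z 1 / (z (-1) + z 1) ≤ γ + ε) :
    z (y - 1) / (z (y - 1) + z (y + 1)) * lyapunov γ ε (y - 1) (bump z (y - 1)) +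
      z (y + 1) / (z (y - 1) + z (y + 1)) * lyapunov γ ε (y + 1) (bump z (y + 1))
      ≤ lyapunov γ ε y z := by
  have h' : ∀ v, 0 < z v := fun v => lt_of_lt_of_le one_pos (hz v)
  have hE := excursionCost_pos ε
  have hA := sideWeight_pos h
  have ha := h' (-1)
  have hb := h' 0
  have hc := h' 1
  have hd := h' 2
  have avg : ∀ p q u v w : ℝ, 0 < p → 0 < q → u ≤ w → v ≤ w →
      p / (p + q) * u + q / (p + q) * v ≤ w := by
    intro p q u v w hp hq hu hv
    have : p / (p + q) * w + q / (p + q) * w = w := by field_simp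
    rw [← this]
    gcongr
  rcases lt_or_ge y 0 with hy0 | hy0
  · apply avg _ _ _ _ _ (h' _) (h' _)
    · rw [lyapunov_of_neg (by lia), lyapunov_of_neg hy0]
      simp only [bump]
      rw [if_neg (by lia), if_neg (by lia), if_neg (by lia), if_neg (by lia)]
      simp
    · rcases lt_or_ge (y + 1) 0 with hy1 | hy1
      · rw [lyapunov_of_neg hy1, lyapunov_of_neg hy0]
        simp only [bump]
        rw [if_neg (by lia : y + 1 ≠ 0), if_neg (by lia : y + 1 ≠ 1),
          if_neg (by lia : y + 1 ≠ 2)]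
        simp only [add_zero]
        gcongr
        split_ifs
        · exact ratioEnergy_add_left_le γ ε ha hc
        · simp
      -- Arriving at 0 adds one to b, and the denominator b - 1 used at 0 undoes exactly this.
      · obtain rfl : y = -1 := by lia
        rw [lyapunov_of_neg hy0]
        norm_num [lyapunov_zero, bump]
  · obtain rfl | rfl | rfl : y = 0 ∨ y = 1 ∨ y = 2 := by lia
    · have h1 := ratioEnergy_average_le γ ε ha hc
      have h2 := sideEnergy_average_le h ha hz0 hc hd hM hα
      rw [zero_sub, zero_add, lyapunov_of_neg (by norm_num), lyapunov_zero, lyapunov_one]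
      norm_num [bump]
      linarith
    · norm_num [lyapunov_zero, lyapunov_one, lyapunov_two, bump]
      have hb1 : 0 < z 0 - 1 := by linarith
      -- From 1 the average is exactly preserved.
      apply le_of_eq
      field_simp
      ring
    · norm_num [lyapunov_three, lyapunov_one, lyapunov_two, bump, hz3]
      have h1 := ratioEnergy_add_right_le hγ ε ha hc
      have hb1 : 0 < z 0 - 1 := by linarith
      have h2 : z 2 * (sideWeight γ ε + excursionCost ε / (z 1 + 1 + 1)) / (z 0 - 1) ≤
          z 2 * (sideWeight γ ε + excursionCost ε / (z 1 + 1)) / (z 0 - 1) := by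
        gcongr; linarith
      -- The first term pays for hitting 3, which has probability 1/(c+1) because `z 3 = 1`; the
      -- second pays for the rise of `ratioEnergy` on returning to 1.
      have h3 : excursionCost ε / (z 1 + 1) = 1 / (z 1 + 1) + 3 / ε ^ 2 / (z 1 + 1) := by
        unfold excursionCost; rw [add_div]
      have h4 : z 1 / (z 1 + 1) ≤ 1 := by rw [div_le_one (by positivity)]; linarith
      have h5 : 0 ≤ ratioEnergy γ ε (z (-1)) (z 1 + 1) +
          z 2 * (sideWeight γ ε + excursionCost ε / (z 1 + 1 + 1)) / (z 0 - 1) := by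
        have := ratioEnergy_nonneg γ ε ha (by linarith : 0 < z 1 + 1)
        positivity
      have h6 := mul_le_mul_of_nonneg_right h4 h5
      rw [one_div] at h3
      linarith

/-! ### Size of the Lyapunov function at time m. -/

theorem rpow_sub_one_le_of_le_mul {b c k γ : ℝ} (hb : 0 < b) (hc : 0 < c) (hk : 1 ≤ k)
    (hγ0 : 0 ≤ γ) (hγ1 : γ < 1) (hcb : c ≤ k * b) : b ^ (γ - 1) ≤ k * c ^ (γ - 1) := by
  have hk0 : 0 < k := by linarith
  have h1 : (k * b) ^ (γ - 1) ≤ c ^ (γ - 1) :=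
    Real.rpow_le_rpow_of_nonpos hc hcb (by linarith)
  rw [Real.mul_rpow hk0.le hb.le] at h1
  have h2 : k ^ (-1 : ℝ) ≤ k ^ (γ - 1) := Real.rpow_le_rpow_of_exponent_le hk (by linarith)
  rw [Real.rpow_neg_one] at h2
  have hb' : 0 < b ^ (γ - 1) := Real.rpow_pos_of_pos hb _
  have h3 : k⁻¹ * b ^ (γ - 1) ≤ c ^ (γ - 1) :=
    (mul_le_mul_of_nonneg_right h2 hb'.le).trans h1
  rwa [inv_mul_le_iff₀ hk0] at h3

/-- The constant of the final estimate. -/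
noncomputable def boundConst (γ ε C : ℝ) : ℝ :=
  1 + 1 / ε ^ 2 + excursionCost ε +
    2 * C * (1 + C) * (sideWeight γ ε + excursionCost ε)

theorem one_le_boundConst {γ ε C : ℝ} (h : γ + ε < 1) (hC : 0 < C) :
    1 ≤ boundConst γ ε C := by
  have hE := excursionCost_pos ε
  have hA := sideWeight_pos h
  have h1 : 0 ≤ 1 / ε ^ 2 + excursionCost ε +
    2 * C * (1 + C) * (sideWeight γ ε + excursionCost ε) := by positivity
  unfold boundConst
  linarith

/-- The excess of α over γ vanishes, so `ratioEnergy` reduces to its 1/(a+c) term. Since b ≥ 2,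
d/(b-1) ≤ 2C b^(γ-1), and c ≤ b + d ≤ (1+C)b trades b for c. -/
theorem lyapunov_le {γ ε C : ℝ} (hγ0 : 0 ≤ γ) (hγ1 : γ < 1) (hε : 0 < ε) (h : γ + ε < 1)
    (hC : 0 < C) {y : ℤ} (hy : y ≤ 2) {z : ℤ → ℝ} (hz : ∀ v, 1 ≤ z v) (hz0 : 2 ≤ z 0)
    (hcbd : z 1 ≤ z 0 + z 2) (hd : z 2 ≤ C * z 0 ^ γ) (hα : z 1 / (z (-1) + z 1) ≤ γ) :
    lyapunov γ ε y z ≤ boundConst γ ε C * z 1 ^ (γ + ε - 1) := by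
  have h' : ∀ v, 0 < z v := fun v => lt_of_lt_of_le one_pos (hz v)
  have hE := excursionCost_pos ε
  have hA := sideWeight_pos h
  have a0 := h' (-1)
  have b0 := h' 0
  have c0 := h' 1
  have d0 := h' 2
  set r := z 1 ^ (γ + ε - 1) with hr
  have hr0 : 0 < r := Real.rpow_pos_of_pos c0 _
  have hinv : 1 / z 1 ≤ r := by
    rw [one_div, ← Real.rpow_neg_one]
    exact Real.rpow_le_rpow_of_exponent_le (hz 1) (by linarith)
  have hdb : z 2 ≤ C * z 0 := hd.trans <| by
    gcongr
    calc z 0 ^ γ ≤ z 0 ^ (1 : ℝ) := Real.rpow_le_rpow_of_exponent_le (hz 0) hγ1.le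
      _ = z 0 := Real.rpow_one _
  have hbr : z 0 ^ (γ - 1) ≤ (1 + C) * r := by
    refine (rpow_sub_one_le_of_le_mul b0 c0 (by linarith : 1 ≤ 1 + C) hγ0 hγ1
      (by linarith)).trans ?_
    gcongr
    exact Real.rpow_le_rpow_of_exponent_le (hz 1) (by linarith)
  have hdb1 : z 2 / (z 0 - 1) ≤ 2 * C * (1 + C) * r := by
    have hb1 : 0 < z 0 - 1 := by linarith
    rw [div_le_iff₀ hb1]
    have e : z 0 ^ γ = z 0 ^ (γ - 1) * z 0 := by
      rw [Real.rpow_sub_one b0.ne']; field_simp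
    calc z 2 ≤ C * (z 0 ^ (γ - 1) * z 0) := by rw [← e]; exact hd
      _ ≤ C * (((1 + C) * r) * (2 * (z 0 - 1))) := by gcongr; linarith
      _ = 2 * C * (1 + C) * r * (z 0 - 1) := by ring
  have hL : ratioEnergy γ ε (z (-1)) (z 1) ≤ 1 / ε ^ 2 * r := by
    unfold ratioEnergy
    rw [max_eq_right (by linarith), div_mul_eq_mul_div, one_mul]
    gcongr
    rw [zero_pow two_ne_zero, zero_add]
    refine le_trans ?_ hinv
    gcongr
    linarith
  have hEc : excursionCost ε / (z 1 + 1) ≤ excursionCost ε * r := by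
    rw [← mul_one_div]
    gcongr
    refine le_trans ?_ hinv
    gcongr
    linarith
  have hEc' : excursionCost ε / (z 1 + 1) ≤ excursionCost ε :=
    div_le_self hE.le (by linarith)
  have hb1 : 0 < z 0 - 1 := by linarith
  set S := sideWeight γ ε with hS
  set F := excursionCost ε with hF
  have hmain : z 2 * (S + F / (z 1 + 1)) / (z 0 - 1) ≤ 2 * C * (1 + C) * r * (S + F) := by
    rw [mul_div_right_comm]
    gcongr
  have hside : sideEnergy γ ε y (z 0) (z 1) (z 2) ≤
      F / (z 1 + 1) + z 2 * (S + F / (z 1 + 1)) / (z 0 - 1) := by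
    have p1 : 0 ≤ F / (z 1 + 1) := by positivity
    have p2 : S * z 2 / (z 0 - 1) ≤ z 2 * (S + F / (z 1 + 1)) / (z 0 - 1) := by
      rw [mul_comm]; gcongr; linarith
    have p3 : S * z 2 / z 0 ≤ S * z 2 / (z 0 - 1) := by
      gcongr; linarith
    unfold sideEnergy
    rw [← hS, ← hF]
    split_ifs <;> linarith
  rw [lyapunov, if_neg (by lia)]
  unfold boundConst
  rw [← hS, ← hF]
  nlinarith

end VRRW

namespace VRRW

open scoped ENNReal

/-! ### Nearest-neighbour paths and their local times. -/

section Deterministic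

variable {Ω : Type*} (Y : ℕ → Ω → ℤ)

theorem Z_zero (v : ℤ) (ω : Ω) : Z Y 0 v ω = (if Y 0 ω = v then 1 else 0) + 1 := by
  simp only [Z, zero_add, Finset.sum_range_one]

theorem Z_succ (n : ℕ) (v : ℤ) (ω : Ω) :
    Z Y (n + 1) v ω = Z Y n v ω + if Y (n + 1) ω = v then 1 else 0 := by
  simp only [Z]
  rw [Finset.sum_range_succ]
  lia

theorem one_le_Z (n : ℕ) (v : ℤ) (ω : Ω) : 1 ≤ Z Y n v ω := Nat.le_add_left 1 _

theorem Z_mono (v : ℤ) (ω : Ω) : Monotone fun n => Z Y n v ω :=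
  monotone_nat_of_le_succ fun n => by rw [Z_succ]; exact Nat.le_add_right _ _

variable {Y}

theorem Z_le_add_of_nearestNeighbor {ω : Ω}
    (h : ∀ n, Y (n + 1) ω = Y n ω - 1 ∨ Y (n + 1) ω = Y n ω + 1) (n : ℕ) (v : ℤ) :
    Z Y n v ω ≤ Z Y n (v - 1) ω + Z Y n (v + 1) ω := by
  -- Between two visits to v there is a visit to a neighbour. The indicator records that a walk now
  -- at v has not yet followed its last visit by one.
  suffices Z Y n v ω + 1 ≤ Z Y n (v - 1) ω + Z Y n (v + 1) ω + if Y n ω = v then 1 else 0 by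
    split_ifs at this <;> lia
  induction n with
  | zero => simp only [Z_zero]; split_ifs <;> lia
  | succ n ih =>
    simp only [Z_succ]
    have := h n
    split_ifs at ih ⊢ <;> lia

theorem le_of_Z_eq_one {ω : Ω}
    (h : ∀ n, Y (n + 1) ω = Y n ω - 1 ∨ Y (n + 1) ω = Y n ω + 1) {n : ℕ} {u v : ℤ}
    (huv : u < v) (hv : Z Y n v ω = 1) (hu : Z Y n u ω ≠ 1) : Y n ω < v := by
  -- Inductive invariant: a path avoiding v stays on one side of it, and on the upper side it cannot
  -- have seen u.
  suffices Y n ω < v ∨ (v < Y n ω ∧ Z Y n u ω = 1) from this.resolve_right fun h => hu h.2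
  clear hu
  induction n with
  | zero =>
    simp only [Z_zero] at *
    split_ifs at * <;> lia
  | succ n ih =>
    simp only [Z_succ] at *
    have := h n
    have := one_le_Z Y n v ω
    split_ifs at * <;> lia

theorem ZInf_ne_one_iff (v : ℤ) (ω : Ω) : ZInf Y v ω ≠ 1 ↔ ∃ n, Y n ω = v := by
  have h : ZInf Y v ω = 1 ↔ {k : ℕ | Y k ω = v} = ∅ := by
    rw [← Set.encard_eq_zero, ZInf]
    constructor
    · intro h
      exact WithTop.add_right_cancel (z := 1) (by simp) (h.trans (zero_add 1).symm)
    · intro h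
      rw [h, zero_add]
  rw [Ne, h, ← Ne, ← Set.nonempty_iff_ne_empty]
  rfl

theorem Z_ne_one_iff (n : ℕ) (v : ℤ) (ω : Ω) : Z Y n v ω ≠ 1 ↔ ∃ k ≤ n, Y k ω = v := by
  induction n with
  | zero => simp [Z_zero]
  | succ n ih =>
    rw [Z_succ]
    have := one_le_Z Y n v ω
    constructor
    · intro h
      by_cases h1 : Y (n + 1) ω = v
      · exact ⟨n + 1, le_rfl, h1⟩
      · rw [if_neg h1, add_zero, ih] at h
        obtain ⟨k, hk, h⟩ := h
        exact ⟨k, by lia, h⟩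
    · rintro ⟨k, hk, h⟩
      rcases hk.lt_or_eq with hk | rfl
      · have := ih.2 ⟨k, by lia, h⟩
        lia
      · rw [if_pos h]; lia

end Deterministic

/-! ### Integration against conditional distributions. -/

section Probability

variable {Ω : Type*} {m mΩ : MeasurableSpace Ω} {P : Measure Ω}

theorem setLIntegral_ofReal_condExp_indicator [IsProbabilityMeasure P]
    (hm : m ≤ mΩ) {S : Set Ω} (hS : MeasurableSet S) {B : Set Ω} (hB : MeasurableSet[m] B) :
    ∫⁻ ω in B, ENNReal.ofReal ((P⟦S | m⟧) ω) ∂P = P (S ∩ B) := by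
  have hint : Integrable (S.indicator fun _ => (1 : ℝ)) P := (integrable_const 1).indicator hS
  rw [← ofReal_integral_eq_lintegral_ofReal integrable_condExp.integrableOn,
    setIntegral_condExp hm hint hB, integral_indicator_const _ hS, smul_eq_mul, mul_one,
    measureReal_restrict_apply hS, ofReal_measureReal]
  exact ae_restrict_of_ae
    (condExp_nonneg (ae_of_all _ fun ω => Set.indicator_nonneg (fun _ _ => zero_le_one) ω))

/-- The restriction of P to S and the measure with density P(S | m) agree on m, by the defining
property of conditional expectation, and W only sees m. -/
theorem setLIntegral_eq_lintegral_condExp_mul [IsProbabilityMeasure P]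
    (hm : m ≤ mΩ) {S : Set Ω} (hS : MeasurableSet S) {W : Ω → ℝ≥0∞} (hW : Measurable[m] W) :
    ∫⁻ ω in S, W ω ∂P = ∫⁻ ω, ENNReal.ofReal ((P⟦S | m⟧) ω) * W ω ∂P := by
  have hq : Measurable fun ω => ENNReal.ofReal ((P⟦S | m⟧) ω) :=
    (stronglyMeasurable_condExp.mono hm).measurable.ennreal_ofReal
  have key : (P.restrict S).trim hm
      = (P.withDensity fun ω => ENNReal.ofReal ((P⟦S | m⟧) ω)).trim hm := by
    refine @Measure.ext _ m _ _ fun B hB => ?_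
    rw [trim_measurableSet_eq hm hB, trim_measurableSet_eq hm hB,
      withDensity_apply _ (hm B hB), setLIntegral_ofReal_condExp_indicator hm hS hB,
      Measure.restrict_apply (hm B hB), Set.inter_comm]
  rw [← lintegral_trim hm hW, key, lintegral_trim hm hW,
    lintegral_withDensity_eq_lintegral_mul _ hq (hW.mono hm le_rfl)]
  rfl

/-- Integration of a function of the past and of an integer-valued variable, against the
conditional distribution of the latter. -/
theorem lintegral_eq_lintegral_tsum_condExp [IsProbabilityMeasure P]
    (hm : m ≤ mΩ) {V : Ω → ℤ} (hV : Measurable V) {p : ℤ → Ω → ℝ}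
    (hp : ∀ j, P⟦V ⁻¹' {j} | m⟧ =ᵐ[P] p j) {W : ℤ → Ω → ℝ≥0∞}
    (hW : ∀ j, Measurable[m] (W j)) :
    ∫⁻ ω, W (V ω) ω ∂P = ∫⁻ ω, ∑' j, ENNReal.ofReal (p j ω) * W j ω ∂P := by
  have hS : ∀ j : ℤ, MeasurableSet (V ⁻¹' {j}) := fun j => hV (measurableSet_singleton j)
  have e1 : ∀ ω, W (V ω) ω = ∑' j, (V ⁻¹' {j}).indicator (W j) ω := by
    intro ω
    rw [tsum_eq_single (V ω)]
    · simp
    · intro j hj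
      have h : ω ∉ V ⁻¹' {j} := fun h : V ω = j => hj h.symm
      exact Set.indicator_of_notMem h (W j)
  have e2 : ∀ᵐ ω ∂P, ∑' j, ENNReal.ofReal (p j ω) * W j ω
      = ∑' j, ENNReal.ofReal ((P⟦V ⁻¹' {j} | m⟧) ω) * W j ω := by
    filter_upwards [ae_all_iff.2 hp] with ω hω
    exact tsum_congr fun j => by rw [hω j]
  rw [lintegral_congr_ae e2, lintegral_congr e1, lintegral_tsum, lintegral_tsum]
  · refine tsum_congr fun j => ?_
    rw [lintegral_indicator (hS j), setLIntegral_eq_lintegral_condExp_mul hm (hS j) (hW j)]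
  · exact fun j => (((stronglyMeasurable_condExp.mono hm).measurable.ennreal_ofReal).mul
      ((hW j).mono hm le_rfl)).aemeasurable
  · exact fun j => (((hW j).mono hm le_rfl).indicator (hS j)).aemeasurable

end Probability

end VRRW

namespace VRRW

open scoped ENNReal

/-! ### One-step expectations for the walk. -/

section Walk

variable {Ω : Type*} {mΩ : MeasurableSpace Ω} {P : Measure Ω}

/-- `Y` is adapted to `F` and moves like a vertex-reinforced random walk with respect to `F`. -/
structure IsReinforcedStep (P : Measure Ω) (F : Filtration ℕ mΩ) (Y : ℕ → Ω → ℤ) : Prop where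
  measurable : ∀ n, Measurable[F n] (Y n)
  step : ∀ (n : ℕ) (j : ℤ), P⟦Y (n + 1) ⁻¹' {j} | F n⟧ =ᵐ[P] fun ω =>
    if j = Y n ω - 1 ∨ j = Y n ω + 1 then
      (Z Y n j ω : ℝ) / ((Z Y n (Y n ω - 1) ω : ℝ) + (Z Y n (Y n ω + 1) ω : ℝ))
    else 0

variable {F : Filtration ℕ mΩ} {Y : ℕ → Ω → ℤ}

theorem IsReinforcedStep.measurable_Z (hY : IsReinforcedStep P F Y) (n : ℕ) (v : ℤ) :
    Measurable[F n] (Z Y n v) := by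
  have h : ∀ k ∈ Finset.range (n + 1),
      Measurable[F n] fun ω => if Y k ω = v then (1 : ℕ) else 0 := fun k hk =>
    Measurable.ite (F.mono (Nat.lt_succ_iff.1 (Finset.mem_range.1 hk)) _
      (hY.measurable k (measurableSet_singleton v))) measurable_const measurable_const
  exact (Finset.measurable_fun_sum _ h).add_const 1

theorem IsReinforcedStep.measurable_alpha (hY : IsReinforcedStep P F Y) (s : ℤ) (n : ℕ)
    (v : ℤ) : Measurable[F n] (α Y s n v) := by
  have h : ∀ v, Measurable[F n] fun ω => (Z Y n v ω : ℝ) := fun v =>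
    measurable_from_top.comp (hY.measurable_Z n v)
  exact (h _).div ((h _).add (h _))

/-- One step of the walk, for the expectation of a function of the past and of the new
position. -/
theorem IsReinforcedStep.lintegral_succ [IsProbabilityMeasure P] (hY : IsReinforcedStep P F Y)
    (n : ℕ) {W : ℤ → Ω → ℝ≥0∞} (hW : ∀ j, Measurable[F n] (W j)) :
    ∫⁻ ω, W (Y (n + 1) ω) ω ∂P = ∫⁻ ω,
      (ENNReal.ofReal ((Z Y n (Y n ω - 1) ω : ℝ) /
          ((Z Y n (Y n ω - 1) ω : ℝ) + (Z Y n (Y n ω + 1) ω : ℝ))) * W (Y n ω - 1) ω +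
        ENNReal.ofReal ((Z Y n (Y n ω + 1) ω : ℝ) /
          ((Z Y n (Y n ω - 1) ω : ℝ) + (Z Y n (Y n ω + 1) ω : ℝ))) * W (Y n ω + 1) ω) ∂P := by
  rw [lintegral_eq_lintegral_tsum_condExp (F.le n) ((hY.measurable (n + 1)).mono (F.le _) le_rfl)
    (hY.step n) hW]
  refine lintegral_congr fun ω => ?_
  rw [tsum_eq_sum (s := {Y n ω - 1, Y n ω + 1}), Finset.sum_pair (by lia)]
  · simp
  · intro j hj
    rw [if_neg (by simpa using hj)]
    simp

/-- The one-step formula is applied to the indicator that j is not a neighbour of the current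
position, which vanishes at both possible targets. -/
theorem IsReinforcedStep.ae_nearestNeighbor [IsProbabilityMeasure P]
    (hY : IsReinforcedStep P F Y) :
    ∀ᵐ ω ∂P, ∀ n, Y (n + 1) ω = Y n ω - 1 ∨ Y (n + 1) ω = Y n ω + 1 := by
  refine ae_all_iff.2 fun n => ?_
  have hm := hY.measurable n
  have hS : ∀ j, MeasurableSet[F n] {ω | j = Y n ω - 1 ∨ j = Y n ω + 1} := fun j =>
    hm (MeasurableSet.of_discrete (s := {y | j = y - 1 ∨ j = y + 1}))
  have h := hY.lintegral_succ n
    (W := fun j => {ω | j = Y n ω - 1 ∨ j = Y n ω + 1}ᶜ.indicator fun _ => 1)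
    fun j => measurable_const.indicator (hS j).compl
  have hmeas : MeasurableSet {ω | Y (n + 1) ω = Y n ω - 1 ∨ Y (n + 1) ω = Y n ω + 1}ᶜ := by
    have h1 := (hm.mono (F.le n) le_rfl)
    have h2 := (hY.measurable (n + 1)).mono (F.le _) le_rfl
    exact (h2.prodMk h1) (MeasurableSet.of_discrete
      (s := {q : ℤ × ℤ | q.1 = q.2 - 1 ∨ q.1 = q.2 + 1}ᶜ))
  have e : ∀ ω, ({ω' | Y (n + 1) ω = Y n ω' - 1 ∨ Y (n + 1) ω = Y n ω' + 1}ᶜ.indicator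
      (fun _ => (1 : ℝ≥0∞)) ω) =
      {ω | Y (n + 1) ω = Y n ω - 1 ∨ Y (n + 1) ω = Y n ω + 1}ᶜ.indicator (fun _ => 1) ω :=
    fun ω => rfl
  simp only [e] at h
  rw [lintegral_indicator_const hmeas, one_mul] at h
  rw [ae_iff]
  refine Eq.trans ?_ (h.trans ?_)
  · rfl
  · simp

/-- The real-valued occupation profile of the walk at time `n`. -/
noncomputable def profile (Y : ℕ → Ω → ℤ) (n : ℕ) (ω : Ω) : ℤ → ℝ := fun v => (Z Y n v ω : ℝ)

theorem one_le_profile (Y : ℕ → Ω → ℤ) (n : ℕ) (ω : Ω) (v : ℤ) : 1 ≤ profile Y n ω v :=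
  Nat.one_le_cast.2 (one_le_Z Y n v ω)

theorem profile_succ (Y : ℕ → Ω → ℤ) (n : ℕ) (ω : Ω) :
    profile Y (n + 1) ω = bump (profile Y n ω) (Y (n + 1) ω) := by
  funext v
  simp only [profile, bump, Z_succ]
  split_ifs <;> simp

theorem IsReinforcedStep.measurable_lyapunov_bump (hY : IsReinforcedStep P F Y) (γ ε : ℝ)
    (n : ℕ) (j : ℤ) :
    Measurable[F n] fun ω => lyapunov γ ε j (bump (profile Y n ω) j) := by
  have h : ∀ v, Measurable[F n] fun ω => bump (profile Y n ω) j v := fun v =>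
    (measurable_from_top.comp (hY.measurable_Z n v)).add measurable_const
  have h1 := h (-1)
  have h2 := h 0
  have h3 := h 1
  have h4 := h 2
  unfold lyapunov ratioEnergy sideEnergy
  split_ifs <;> fun_prop

/-! ### The stopped supermartingale and the escape event. -/

/-- Up to time `n`, site `3` has not been visited and, since time `m`, the fraction
`α` has not exceeded `β`. -/
def goodSet (Y : ℕ → Ω → ℤ) (β : ℝ) (m n : ℕ) : Set Ω :=
  {ω | Z Y n 3 ω = 1 ∧ ∀ k, m ≤ k → k ≤ n → α Y 1 k 0 ω ≤ β}

theorem goodSet_antitone (Y : ℕ → Ω → ℤ) (β : ℝ) (m : ℕ) : Antitone (goodSet Y β m) := by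
  rintro n n' h ω ⟨h1, h2⟩
  refine ⟨le_antisymm ?_ (one_le_Z Y n 3 ω), fun k hk hk' => h2 k hk (hk'.trans h)⟩
  rw [← h1]
  exact Z_mono Y 3 ω h

theorem IsReinforcedStep.measurableSet_goodSet (hY : IsReinforcedStep P F Y) (β : ℝ)
    (m n : ℕ) : MeasurableSet[F n] (goodSet Y β m n) := by
  have e : goodSet Y β m n = Z Y n 3 ⁻¹' {1} ∩
      ⋂ k ∈ Set.Icc m n, α Y 1 k 0 ⁻¹' Set.Iic β := by
    ext ω; simp [goodSet]
  rw [e]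
  refine (hY.measurable_Z n 3 (measurableSet_singleton 1)).inter ?_
  refine MeasurableSet.biInter (Set.to_countable _) fun k hk => ?_
  exact F.mono hk.2 _ (hY.measurable_alpha 1 k 0 measurableSet_Iic)

theorem alpha_one_zero (Y : ℕ → Ω → ℤ) (n : ℕ) (ω : Ω) :
    α Y 1 n 0 ω = profile Y n ω 1 / (profile Y n ω (-1) + profile Y n ω 1) := by
  simp [α, profile]

/-- The potential of the walk at time `n`. -/
noncomputable def energy (γ ε : ℝ) (Y : ℕ → Ω → ℤ) (n : ℕ) (ω : Ω) : ℝ≥0∞ :=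
  ENNReal.ofReal (lyapunov γ ε (Y n ω) (profile Y n ω))

theorem IsReinforcedStep.setLIntegral_energy_succ_le [IsProbabilityMeasure P]
    (hY : IsReinforcedStep P F Y) {γ ε : ℝ} (hγ : 0 ≤ γ) (h : γ + ε < 1) {m n : ℕ}
    (hmn : m ≤ n) {A : Set Ω} (hA : MeasurableSet[F m] A) (hA0 : ∀ ω ∈ A, 2 ≤ Z Y m 0 ω) :
    ∫⁻ ω in A ∩ goodSet Y (γ + ε) m n, energy γ ε Y (n + 1) ω ∂P
      ≤ ∫⁻ ω in A ∩ goodSet Y (γ + ε) m n, energy γ ε Y n ω ∂P := by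
  set S := A ∩ goodSet Y (γ + ε) m n with hS
  have hSm : MeasurableSet[F n] S :=
    (F.mono hmn _ hA).inter (hY.measurableSet_goodSet (γ + ε) m n)
  have hSm' := F.le n _ hSm
  -- Freezing the new position at j leaves a function of the past, as the one-step formula requires.
  have key := hY.lintegral_succ n
    (W := fun j => S.indicator fun ω =>
      ENNReal.ofReal (lyapunov γ ε j (bump (profile Y n ω) j)))
    fun j => (hY.measurable_lyapunov_bump γ ε n j).ennreal_ofReal.indicator hSm
  have e : ∀ ω, S.indicator (energy γ ε Y (n + 1)) ω =
      S.indicator (fun ω' => ENNReal.ofReal (lyapunov γ ε (Y (n + 1) ω)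
        (bump (profile Y n ω') (Y (n + 1) ω)))) ω := by
    intro ω
    by_cases hω : ω ∈ S
    · simp only [Set.indicator_of_mem hω, energy, profile_succ]
    · simp only [Set.indicator_of_notMem hω]
  rw [← lintegral_indicator hSm', ← lintegral_indicator hSm', lintegral_congr e, key]
  refine lintegral_mono_ae ?_
  filter_upwards [hY.ae_nearestNeighbor] with ω hω
  by_cases hωS : ω ∈ S
  · simp only [Set.indicator_of_mem hωS]
    obtain ⟨hωA, hω3, hωα⟩ := hωS
    have hz := one_le_profile Y n ω
    have hz' : ∀ v, 0 < profile Y n ω v := fun v => one_pos.trans_le (hz v)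
    have hz0 : 2 ≤ Z Y n 0 ω := (hA0 ω hωA).trans (Z_mono Y 0 ω hmn)
    have hy : Y n ω < 3 := le_of_Z_eq_one hω (by norm_num : (0 : ℤ) < 3) hω3 (by lia)
    have hM := Z_le_add_of_nearestNeighbor hω n 0
    have hlt := lyapunov_average_le hγ h (y := Y n ω) (by lia) hz
      (by simpa [profile] using (by exact_mod_cast hz0 : (2 : ℝ) ≤ Z Y n 0 ω))
      (by simp [profile, hω3]) (by simp only [profile]; exact_mod_cast hM)
      (by rw [← alpha_one_zero]; exact hωα n hmn le_rfl)
    have hbump : ∀ j v, 1 ≤ bump (profile Y n ω) j v := by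
      intro j v
      have := hz v
      unfold bump
      split_ifs <;> linarith
    rw [energy]
    refine le_trans (le_of_eq ?_) (ENNReal.ofReal_le_ofReal hlt)
    have hq : ∀ u v w : ℤ, 0 ≤ profile Y n ω u / (profile Y n ω v + profile Y n ω w) :=
      fun u v w => div_nonneg (hz' u).le (add_pos (hz' v) (hz' w)).le
    rw [ENNReal.ofReal_add (mul_nonneg (hq _ _ _) (lyapunov_nonneg h _ (hbump _)))
      (mul_nonneg (hq _ _ _) (lyapunov_nonneg h _ (hbump _))),
      ENNReal.ofReal_mul (hq _ _ _), ENNReal.ofReal_mul (hq _ _ _)]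
    rfl
  · simp [Set.indicator_of_notMem hωS]

/-- Optional stopping in integrated form: mass that leaves the good set at a step carries energy at
least 1 there, and total energy on the previous good set does not increase in that step. -/
theorem IsReinforcedStep.measure_diff_goodSet_add_le [IsProbabilityMeasure P]
    (hY : IsReinforcedStep P F Y) {γ ε : ℝ} (hγ : 0 ≤ γ) (hε : 0 < ε) (h : γ + ε < 1) {m : ℕ}
    {A : Set Ω} (hA : MeasurableSet[F m] A) (hA0 : ∀ ω ∈ A, 2 ≤ Z Y m 0 ω)
    (hAm : A ⊆ goodSet Y (γ + ε) m m) (n : ℕ) (hmn : m ≤ n) :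
    P (A \ goodSet Y (γ + ε) m n) + ∫⁻ ω in A ∩ goodSet Y (γ + ε) m n, energy γ ε Y n ω ∂P
      ≤ ∫⁻ ω in A, energy γ ε Y m ω ∂P := by
  set G := goodSet Y (γ + ε) m with hG
  have hGm : ∀ n, MeasurableSet (G n) := fun n =>
    F.le n _ (hY.measurableSet_goodSet (γ + ε) m n)
  have hAm' := F.le m _ hA
  induction n, hmn using Nat.le_induction with
  | base =>
    rw [Set.sdiff_eq_empty.2 hAm, measure_empty, zero_add, Set.inter_eq_left.2 hAm]
  | succ n hmn ih =>
    refine le_trans ?_ ih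
    have hsub : G (n + 1) ⊆ G n := goodSet_antitone Y (γ + ε) m (Nat.le_succ n)
    have h1 : A \ G (n + 1) ⊆ A \ G n ∪ (A ∩ G n) \ G (n + 1) := by
      intro ω hω
      by_cases hωG : ω ∈ G n
      · exact Or.inr ⟨⟨hω.1, hωG⟩, hω.2⟩
      · exact Or.inl ⟨hω.1, hωG⟩
    have h2 : P ((A ∩ G n) \ G (n + 1)) ≤
        ∫⁻ ω in (A ∩ G n) \ G (n + 1), energy γ ε Y (n + 1) ω ∂P := by
      rw [← setLIntegral_one]
      refine setLIntegral_mono' ((hAm'.inter (hGm n)).diff (hGm (n + 1))) fun ω hω => ?_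
      rw [energy, ENNReal.one_le_ofReal]
      refine one_le_lyapunov hε h _ (one_le_profile Y _ ω) ?_
      obtain ⟨⟨-, hω3, hωα⟩, hω⟩ := hω
      rw [← alpha_one_zero]
      by_contra! hcon
      refine hω ⟨?_, fun k hk hk' => ?_⟩
      · rw [Z_succ, if_neg (by lia), hω3]
      · rcases Nat.le_succ_iff.1 hk' with hk' | rfl
        · exact hωα k hk hk'
        · exact hcon.2.le
    have h3 : ∫⁻ ω in A ∩ G (n + 1), energy γ ε Y (n + 1) ω ∂P +
        ∫⁻ ω in (A ∩ G n) \ G (n + 1), energy γ ε Y (n + 1) ω ∂P =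
        ∫⁻ ω in A ∩ G n, energy γ ε Y (n + 1) ω ∂P := by
      rw [← lintegral_inter_add_sdiff _ (A ∩ G n) (hGm (n + 1)), Set.inter_assoc,
        Set.inter_eq_right.2 hsub]
    calc P (A \ G (n + 1)) + ∫⁻ ω in A ∩ G (n + 1), energy γ ε Y (n + 1) ω ∂P
        ≤ (P (A \ G n) + ∫⁻ ω in (A ∩ G n) \ G (n + 1), energy γ ε Y (n + 1) ω ∂P) +
          ∫⁻ ω in A ∩ G (n + 1), energy γ ε Y (n + 1) ω ∂P := by
          gcongr
          exact (measure_mono h1).trans ((measure_union_le _ _).trans (by gcongr))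
      _ = P (A \ G n) + ∫⁻ ω in A ∩ G n, energy γ ε Y (n + 1) ω ∂P := by
          rw [← h3, add_assoc, add_comm (∫⁻ ω in (A ∩ G n) \ G (n + 1), _ ∂P)]
      _ ≤ _ := by
          gcongr 1
          exact hY.setLIntegral_energy_succ_le hγ h hmn hA hA0

theorem IsReinforcedStep.measure_diff_iInter_goodSet_le [IsProbabilityMeasure P]
    (hY : IsReinforcedStep P F Y) {γ ε : ℝ} (hγ : 0 ≤ γ) (hε : 0 < ε) (h : γ + ε < 1) {m : ℕ}
    {A : Set Ω} (hA : MeasurableSet[F m] A) (hA0 : ∀ ω ∈ A, 2 ≤ Z Y m 0 ω)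
    (hAm : A ⊆ goodSet Y (γ + ε) m m) :
    P (A \ ⋂ n, goodSet Y (γ + ε) m n) ≤ ∫⁻ ω in A, energy γ ε Y m ω ∂P := by
  have hanti := goodSet_antitone Y (γ + ε) m
  rw [Set.sdiff_iInter, Monotone.measure_iUnion
    fun n n' hn => Set.sdiff_subset_sdiff_right (hanti hn)]
  refine iSup_le fun n => ?_
  refine le_trans (measure_mono (Set.sdiff_subset_sdiff_right (hanti (le_max_left n m)))) ?_
  exact le_self_add.trans
    (hY.measure_diff_goodSet_add_le hγ hε h hA hA0 hAm (max n m) (le_max_right n m))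

theorem alpha_le_one (Y : ℕ → Ω → ℤ) {s : ℤ} (hs : s = 1 ∨ s = -1) (n : ℕ) (v : ℤ) (ω : Ω) :
    α Y s n v ω ≤ 1 := by
  have h : ∀ u, (0 : ℝ) < Z Y n u ω := fun u => by exact_mod_cast one_le_Z Y n u ω
  rw [α, div_le_one (add_pos (h _) (h _))]
  rcases hs with rfl | rfl
  · linarith [h (v - 1)]
  · rw [← sub_eq_add_neg]; linarith [h (v + 1)]

/-- The event whose conditional probability is to be bounded. -/
def escapeSet (Y : ℕ → Ω → ℤ) (β : ℝ) (m : ℕ) : Set Ω :=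
  {ω | ZInf Y 3 ω ≠ 1} ∪ {ω | β < ⨆ n : Set.Ici m, α Y 1 (n : ℕ) 0 ω}

theorem escapeSet_eq (Y : ℕ → Ω → ℤ) (β : ℝ) (m : ℕ) :
    escapeSet Y β m = (⋂ n, goodSet Y β m n)ᶜ := by
  ext ω
  -- Boundedness makes the real `⨆` a true supremum instead of the default 0.
  have hbdd : BddAbove (Set.range fun n : Set.Ici m => α Y 1 (n : ℕ) 0 ω) :=
    ⟨1, by rintro _ ⟨n, rfl⟩; exact alpha_le_one Y (Or.inl rfl) _ _ _⟩
  have h1 : β < ⨆ n : Set.Ici m, α Y 1 (n : ℕ) 0 ω ↔ ∃ n, m ≤ n ∧ β < α Y 1 n 0 ω := by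
    rw [lt_ciSup_iff hbdd]
    simp
  have h2 : ZInf Y 3 ω ≠ 1 ↔ ∃ n, Z Y n 3 ω ≠ 1 := by
    rw [ZInf_ne_one_iff]
    simp only [Z_ne_one_iff]
    exact ⟨fun ⟨n, hn⟩ => ⟨n, n, le_rfl, hn⟩, fun ⟨n, k, _, hk⟩ => ⟨k, hk⟩⟩
  simp only [escapeSet, Set.mem_union, Set.mem_ofPred_eq, h1, h2, Set.mem_compl_iff,
    Set.mem_iInter, goodSet, not_forall, not_and_or, not_le]
  constructor
  · rintro (⟨n, hn⟩ | ⟨n, hmn, hn⟩)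
    · exact ⟨n, Or.inl hn⟩
    · exact ⟨n, Or.inr ⟨n, hmn, le_rfl, hn⟩⟩
  · rintro ⟨n, hn | ⟨k, hmk, -, hk⟩⟩
    · exact Or.inl ⟨n, hn⟩
    · exact Or.inr ⟨k, hmk, hk⟩

/-- The integrated bound holds on every suitable event of the past, in particular on the event T
where the pointwise bound fails; there it contradicts the strict inequality unless T is null. -/
theorem IsReinforcedStep.condExp_escapeSet_le [IsProbabilityMeasure P]
    (hY : IsReinforcedStep P F Y) {γ ε C : ℝ} (hγ0 : 0 ≤ γ) (hγ1 : γ < 1) (hε : 0 < ε)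
    (h : γ + ε < 1) (hC : 0 < C) (m : ℕ) :
    ∀ᵐ ω ∂P, Z Y m 3 ω = 1 → 2 ≤ Z Y m 0 ω →
      (Z Y m 2 ω : ℝ) ≤ C * (Z Y m 0 ω : ℝ) ^ γ → α Y 1 m 0 ω ≤ γ →
      (P⟦escapeSet Y (γ + ε) m | F m⟧) ω
        ≤ boundConst γ ε C * (Z Y m 1 ω : ℝ) ^ (γ + ε - 1) := by
  set q := P⟦escapeSet Y (γ + ε) m | F m⟧ with hq
  set g : Ω → ℝ := fun ω => boundConst γ ε C * (Z Y m 1 ω : ℝ) ^ (γ + ε - 1) with hg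
  have hqm : Measurable[F m] q := stronglyMeasurable_condExp.measurable
  have hZ : ∀ v, Measurable[F m] fun ω => (Z Y m v ω : ℝ) := fun v =>
    measurable_from_top.comp (hY.measurable_Z m v)
  have hgm : Measurable[F m] g := ((hZ 1).pow_const _).const_mul _
  set T : Set Ω := {ω | (Z Y m 3 ω = 1 ∧ 2 ≤ Z Y m 0 ω) ∧
    ((Z Y m 2 ω : ℝ) ≤ C * (Z Y m 0 ω : ℝ) ^ γ ∧ α Y 1 m 0 ω ≤ γ) ∧ g ω < q ω} with hT
  have hTm : MeasurableSet[F m] T := by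
    refine MeasurableSet.inter (MeasurableSet.inter ?_ ?_)
      (MeasurableSet.inter (MeasurableSet.inter ?_ ?_) ?_)
    · exact hY.measurable_Z m 3 (measurableSet_singleton 1)
    · exact hY.measurable_Z m 0 (MeasurableSet.of_discrete (s := {k | 2 ≤ k}))
    · exact measurableSet_le (hZ 2) (((hZ 0).pow_const _).const_mul _)
    · exact hY.measurable_alpha 1 m 0 measurableSet_Iic
    · exact measurableSet_lt hgm hqm
  have hGm : MeasurableSet (escapeSet Y (γ + ε) m) := by
    rw [escapeSet_eq]
    exact (MeasurableSet.iInter fun n =>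
      F.le n _ (hY.measurableSet_goodSet (γ + ε) m n)).compl
  have h1 : ∫⁻ ω in T, ENNReal.ofReal (q ω) ∂P ≤ ∫⁻ ω in T, ENNReal.ofReal (g ω) ∂P := by
    rw [setLIntegral_ofReal_condExp_indicator (F.le m) hGm hTm, escapeSet_eq, Set.inter_comm,
      ← Set.sdiff_eq]
    refine (hY.measure_diff_iInter_goodSet_le hγ0 hε h hTm (fun ω hω => hω.1.2) ?_).trans ?_
    · rintro ω ⟨⟨h3, -⟩, ⟨-, hα⟩, -⟩
      refine ⟨h3, fun k hk hk' => ?_⟩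
      obtain rfl := le_antisymm hk hk'
      linarith
    · refine lintegral_mono_ae ((ae_restrict_iff' (F.le m _ hTm)).2 ?_)
      filter_upwards [hY.ae_nearestNeighbor] with ω hω hωT
      obtain ⟨⟨h3, h0⟩, ⟨h2, hα⟩, -⟩ := hωT
      have hy : Y m ω < 3 := le_of_Z_eq_one hω (by norm_num : (0 : ℤ) < 3) h3 (by lia)
      refine ENNReal.ofReal_le_ofReal (lyapunov_le hγ0 hγ1 hε h hC (by lia)
        (one_le_profile Y m ω) ?_ ?_ h2 (by rwa [← alpha_one_zero]))
      · simp only [profile]; exact_mod_cast h0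
      · have := Z_le_add_of_nearestNeighbor hω m 1
        simp only [profile]
        exact_mod_cast this
  have hT0 : P T = 0 := by
    by_contra hne
    have hfin : ∫⁻ ω in T, ENNReal.ofReal (g ω) ∂P ≠ ∞ := by
      refine ne_top_of_le_ne_top
        (b := ∫⁻ ω in T, ENNReal.ofReal (q ω) ∂P) ?_ (setLIntegral_mono'
        (F.le m _ hTm) fun ω hω => ENNReal.ofReal_le_ofReal hω.2.2.le)
      rw [setLIntegral_ofReal_condExp_indicator (F.le m) hGm hTm]
      exact measure_ne_top _ _
    refine absurd h1 (not_le.2 ?_)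
    refine setLIntegral_strict_mono (F.le m _ hTm) hne
      (hqm.mono (F.le m) le_rfl).ennreal_ofReal hfin (ae_of_all _ fun ω hω => ?_)
    have hg0 : 0 ≤ g ω := mul_nonneg (zero_le_one.trans (one_le_boundConst h hC))
      (Real.rpow_nonneg (Nat.cast_nonneg _) _)
    exact (ENNReal.ofReal_lt_ofReal_iff (hg0.trans_lt hω.2.2)).2 hω.2.2
  filter_upwards [measure_eq_zero_iff_ae_notMem.1 hT0] with ω hω h3 h0 h2 hα
  by_contra! hcon
  exact hω ⟨⟨h3, h0⟩, ⟨h2, hα⟩, hcon⟩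

end Walk

/-! ### Reduction to x = 0 and the sign +. -/

section Reflection

variable {Ω : Type*}

/-- The walk in the coordinate `v ↦ s * (v - x)`. -/
def recenter (X : ℕ → Ω → ℤ) (s x : ℤ) : ℕ → Ω → ℤ := fun n ω => s * (X n ω - x)

theorem recenter_eq_iff (X : ℕ → Ω → ℤ) {s : ℤ} (hs : s = 1 ∨ s = -1) (x j : ℤ) (n : ℕ)
    (ω : Ω) : recenter X s x n ω = j ↔ X n ω = x + s * j := by
  rcases hs with rfl | rfl <;> simp only [recenter] <;> lia

theorem Z_recenter (X : ℕ → Ω → ℤ) {s : ℤ} (hs : s = 1 ∨ s = -1) (x j : ℤ) (n : ℕ)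
    (ω : Ω) : Z (recenter X s x) n j ω = Z X n (x + s * j) ω := by
  simp only [Z, recenter_eq_iff X hs]

theorem ZInf_recenter (X : ℕ → Ω → ℤ) {s : ℤ} (hs : s = 1 ∨ s = -1) (x j : ℤ) (ω : Ω) :
    ZInf (recenter X s x) j ω = ZInf X (x + s * j) ω := by
  simp only [ZInf, recenter_eq_iff X hs]

theorem alpha_recenter (X : ℕ → Ω → ℤ) {s : ℤ} (hs : s = 1 ∨ s = -1) (x : ℤ) (n : ℕ)
    (ω : Ω) : α (recenter X s x) 1 n 0 ω = α X s n x ω := by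
  simp only [α, Z_recenter X hs]
  rcases hs with rfl | rfl
  · simp [← sub_eq_add_neg]
  · simp [← sub_eq_add_neg, add_comm]

/-- The filtration of the original walk is kept, so the conditional probability in the conclusion is
not altered by the change of coordinates. -/
theorem IsVRRW.isReinforcedStep [MeasurableSpace Ω] {P : Measure Ω} {v₀ : ℤ}
    {X : ℕ → Ω → ℤ} (hX : IsVRRW P v₀ X) {s : ℤ} (hs : s = 1 ∨ s = -1)
    (x : ℤ) : IsReinforcedStep P hX.filtration (recenter X s x) where
  measurable n := by
    have h : Measurable[hX.filtration n] (X n) :=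
      (Filtration.stronglyAdapted_natural
        (fun k => (hX.measurable k).stronglyMeasurable) n).measurable
    exact (measurable_from_top (f := fun y : ℤ => s * (y - x))).comp h
  step n j := by
    have e : recenter X s x (n + 1) ⁻¹' {j} = X (n + 1) ⁻¹' {x + s * j} := by
      ext ω
      simp only [Set.mem_preimage, Set.mem_singleton_iff, recenter_eq_iff X hs]
    rw [e]
    refine (hX.step n (x + s * j)).trans (Filter.Eventually.of_forall fun ω => ?_)
    simp only [Z_recenter X hs, recenter]
    rcases hs with rfl | rfl
    · have e1 : x + 1 * (1 * (X n ω - x) - 1) = X n ω - 1 := by ring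
      have e2 : x + 1 * (1 * (X n ω - x) + 1) = X n ω + 1 := by ring
      rw [e1, e2]
      refine if_congr ?_ rfl rfl
      lia
    · have e1 : x + -1 * (-1 * (X n ω - x) - 1) = X n ω + 1 := by ring
      have e2 : x + -1 * (-1 * (X n ω - x) + 1) = X n ω - 1 := by ring
      rw [e1, e2, add_comm (Z X n (X n ω + 1) ω : ℝ)]
      refine if_congr ?_ rfl rfl
      lia

end Reflection

theorem condExp_indicator_one_le_one {Ω : Type*} {m mΩ : MeasurableSpace Ω} (P : Measure Ω)
    [IsProbabilityMeasure P] (hm : m ≤ mΩ) {S : Set Ω}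
    (hS : MeasurableSet S) : ∀ᵐ ω ∂P, (P⟦S | m⟧) ω ≤ 1 := by
  have h := condExp_mono (m := m) ((integrable_const (μ := P) (1 : ℝ)).indicator hS)
    (integrable_const (1 : ℝ))
    (ae_of_all P fun ω => Set.indicator_le_self' (fun _ _ => zero_le_one) ω)
  rw [condExp_const hm] at h
  exact h

end VRRW

/-! ### Degenerate cases and conclusion. -/

theorem mainTheorem7 (γ ε C : ℝ) (hγ0 : 0 ≤ γ) (hγ1 : γ < 1) (hε : 0 < ε) (hC : 0 < C) :
    ∃ K : ℝ, ∀ (Ω : Type*) [MeasurableSpace Ω] (P : Measure Ω) [IsProbabilityMeasure P]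
      (v₀ : ℤ) (X : ℕ → Ω → ℤ) (hX : VRRW.IsVRRW P v₀ X)
      (s : ℤ), (s = 1 ∨ s = -1) → ∀ (x : ℤ) (m : ℕ),
      ∀ᵐ ω ∂P,
        VRRW.Z X m (x + 3 * s) ω = 1 →
        (VRRW.Z X m (x + 2 * s) ω : ℝ) ≤ C * (VRRW.Z X m x ω : ℝ) ^ γ →
        VRRW.α X s m x ω ≤ γ →
        (P⟦{ω' | VRRW.ZInf X (x + 3 * s) ω' ≠ 1} ∪
            {ω' | γ + ε < ⨆ n : Set.Ici m, VRRW.α X s (n : ℕ) x ω'} | hX.filtration m⟧) ω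
          ≤ K * ((VRRW.Z X m x ω : ℝ) ^ (-γ) + (VRRW.Z X m (x + s) ω : ℝ) ^ (γ + ε - 1)) := by
  -- The lower bound 1 on K handles the cases where the estimate is trivial.
  refine ⟨max 1 (VRRW.boundConst γ ε C), ?_⟩
  intro Ω _ P _ v₀ X hX s hs x m
  have hY := hX.isReinforcedStep hs x
  have eset : {ω' | VRRW.ZInf X (x + 3 * s) ω' ≠ 1} ∪
      {ω' | γ + ε < ⨆ n : Set.Ici m, VRRW.α X s (n : ℕ) x ω'} =
      VRRW.escapeSet (VRRW.recenter X s x) (γ + ε) m := by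
    simp only [VRRW.escapeSet, VRRW.ZInf_recenter X hs, VRRW.alpha_recenter X hs, mul_comm s]
  have hmeas : MeasurableSet (VRRW.escapeSet (VRRW.recenter X s x) (γ + ε) m) := by
    rw [VRRW.escapeSet_eq]
    exact (MeasurableSet.iInter fun n =>
      hX.filtration.le n _ (hY.measurableSet_goodSet (γ + ε) m n)).compl
  rw [eset]
  have hb : ∀ ω, (1 : ℝ) ≤ VRRW.Z X m x ω := fun ω => by
    exact_mod_cast VRRW.one_le_Z X m x ω
  have hc : ∀ ω, (1 : ℝ) ≤ VRRW.Z X m (x + s) ω := fun ω => by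
    exact_mod_cast VRRW.one_le_Z X m (x + s) ω
  have hb0 : ∀ ω, 0 ≤ (VRRW.Z X m x ω : ℝ) ^ (-γ) := fun ω =>
    Real.rpow_nonneg (Nat.cast_nonneg _) _
  have hc0 : ∀ ω, 0 ≤ (VRRW.Z X m (x + s) ω : ℝ) ^ (γ + ε - 1) := fun ω =>
    Real.rpow_nonneg (Nat.cast_nonneg _) _
  have hK := le_max_left 1 (VRRW.boundConst γ ε C)
  have hone := VRRW.condExp_indicator_one_le_one P (hX.filtration.le m) hmeas
  rcases le_or_gt 1 (γ + ε) with h | h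
  · filter_upwards [hone] with ω hω _ _ _
    have := Real.one_le_rpow (hc ω) (by linarith : 0 ≤ γ + ε - 1)
    nlinarith [hb0 ω]
  · filter_upwards [hone, hY.condExp_escapeSet_le hγ0 hγ1 hε h hC m] with ω hω hmain h3 h2 hα
    -- If x is still unvisited, Z_m(x)^(-γ) = 1 and the bound is trivial. Only here does that term
    -- contribute; otherwise the second term alone suffices.
    rcases (VRRW.one_le_Z X m x ω).eq_or_lt with hZ | hZ
    · have : (VRRW.Z X m x ω : ℝ) ^ (-γ) = 1 := by
        rw [← hZ, Nat.cast_one, Real.one_rpow]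
      nlinarith [hc0 ω]
    · simp only [VRRW.Z_recenter X hs, VRRW.alpha_recenter X hs, mul_comm s, zero_mul, one_mul,
        add_zero] at hmain
      refine (hmain h3 hZ h2 hα).trans ?_
      exact mul_le_mul (le_max_right _ _) (le_add_of_nonneg_left (hb0 ω)) (hc0 ω)
        (zero_le_one.trans hK)
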